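/- Theorem 2.21 (Wigner's semicircle law for GUE, averaged version). For each $N\ge 1$ let $A_N=\frac1{\sqrt N}(a_{ij})_{i,j=1}^N$ be a GUE($N$) random matrix, i.e. a random $N\times N$ matrix on some probability space such that $A_N=A_N^*$, the entries $\{a_{ij}\mid i\ge j\}$ are independent, each $a_{ii}$ is a standard real Gaussian random variable (mean $0$, variance $1$), and each $a_{ij}$ with $i\ne j$ is a standard complex Gaussian random variable, i.e. of the form $(X+\sqrt{-1}\,Y)/\sqrt2$ with $X,Y$ independent standard real Gaussians. Let $\operatorname{tr}=\frac1N\operatorname{Tr}$ denote the normalized trace. Then for every integer $m\ge 0$ the random variables $\operatorname{tr}(A_N^m)$, $N\ge1$, are integrable and $$\lim_{N\to\infty}\mathbb{E}\left[\operatorname{tr}(A_N^m)\right]=\frac1{2\pi}\int_{-2}^{2}x^m\sqrt{4-x^2}\,dx .$$ The right-hand side, which is the $m$-th moment of the semicircle distribution, equals $0$ if $m$ is odd and equals the Catalan number $C_k=\frac1{k+1}\binom{2k}{k}$ if $m=2k$ is even. -/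

import Mathlib

open MeasureTheory ProbabilityTheory Filter Topology

noncomputable section

namespace GUE

/-- The law, on `ℂ`, of a standard real Gaussian random variable. -/
def stdRealGaussian : Measure ℂ :=
  (gaussianReal 0 1).map (fun x : ℝ => (x : ℂ))

/-- The law of a standard complex Gaussian random variable `(X + iY) / √2`, where `X` and `Y` are
independent standard real Gaussian random variables. -/
def stdComplexGaussian : Measure ℂ :=
  ((gaussianReal 0 1).prod (gaussianReal 0 1)).map
    (fun p : ℝ × ℝ => ((p.1 : ℂ) + Complex.I * (p.2 : ℂ)) / ((Real.sqrt 2 : ℝ) : ℂ))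

/-- `a = (a_{ij})` is a random selfadjoint matrix on the probability space `(Ω, P)` whose entries on
and below the diagonal are independent standard Gaussians, real on the diagonal and complex off
the diagonal. -/
structure IsUnnormalizedGUE {Ω : Type*} [MeasurableSpace Ω] (P : Measure Ω) {N : ℕ}
    (a : Ω → Matrix (Fin N) (Fin N) ℂ) : Prop where
  selfadjoint : ∀ᵐ ω ∂P, (a ω).IsHermitian
  indep : iIndepFun
    (fun (p : {p : Fin N × Fin N // p.2 ≤ p.1}) (ω : Ω) => a ω p.1.1 p.1.2) P
  diag_law : ∀ i : Fin N, HasLaw (fun ω => a ω i i) stdRealGaussian P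
  offDiag_law : ∀ i j : Fin N, i ≠ j → HasLaw (fun ω => a ω i j) stdComplexGaussian P

/-- `A` is a (normalized) GUE(N) random matrix: `A = N^{-1/2} (a_{ij})` with `a` as above. -/
def IsGUE {Ω : Type*} [MeasurableSpace Ω] (P : Measure Ω) {N : ℕ}
    (A : Ω → Matrix (Fin N) (Fin N) ℂ) : Prop :=
  ∃ a : Ω → Matrix (Fin N) (Fin N) ℂ, IsUnnormalizedGUE P a ∧
    ∀ ω, A ω = (((Real.sqrt N)⁻¹ : ℝ) : ℂ) • a ω

/-- The normalized trace `tr = (1/N) Tr`. -/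
def normTrace {N : ℕ} (M : Matrix (Fin N) (Fin N) ℂ) : ℂ :=
  (1 / (N : ℂ)) * M.trace

/-- The `m`-th moment of the semicircle distribution, which has density `√(4 - x²) / (2π)` on
`[-2, 2]`. -/
def semicircleMoment (m : ℕ) : ℝ :=
  1 / (2 * Real.pi) * ∫ x in (-2 : ℝ)..2, x ^ m * Real.sqrt (4 - x ^ 2)

end GUE

end

/-!
# Wigner's semicircle law for the GUE, in expectation

The expectation `φ f = E[f(A)]` is a linear functional on polynomials in the matrix entries, and for
a GUE matrix it satisfies Gaussian integration by parts,
`φ (X i j * f) = N⁻¹ * φ (∂ f / ∂ X j i)` (`IsGUEFunctional`). This is the only property of the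
law that the asymptotics use. With `t k = tr (X ^ k)`, applying it to the expansion of the first
trace in a product gives the Schwinger–Dyson equation
`φ (t (k + 1) * ∏ t l) = ∑_{p + q = k - 1} φ (t p * t q * ∏ t l) + N⁻² * (…)`
(`IsGUEFunctional.map_genTraceProd_cons_succ`), in which every term has smaller total degree and
the number of the remaining terms does not depend on `N`. Working with products of traces
rather than a single trace closes the induction on the total degree without any variance estimate:
`φ (∏ t l)` tends to `∏ c l`, where `c 0 = 1` and `c (k + 1) = ∑_{p + q = k - 1} c p * c q`
(`tendsto_map_genTraceProd`). This is the recursion of the Catalan numbers, interlaced with zeros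
(`semicircleSeq_succ`).

Integration by parts is linear in `f`, so it is enough to check it on monomials
(`polyExpectation_X_mul`). There the entries on and below the diagonal factor by independence, and
what remains is the identity `E[ξ ^ (k + 1) * conj ξ ^ l] = l * E[ξ ^ k * conj ξ ^ (l - 1)]` for a
standard complex Gaussian `ξ`, and its real analogue; both follow from Stein's identity for
polynomials (`integral_mul_eval_gaussianReal`).

The moments of the semicircle density satisfy `(m + 4) I (m + 2) = 4 (m + 1) I m`
(`semicircleMoment_add_two`), which identifies them with the same sequence.
-/

namespace GUE

/-! ### The Catalan numbers interlaced with zeros -/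

/-- The even moments of the semicircle distribution are Catalan numbers, the odd ones vanish. -/
def semicircleSeq (m : ℕ) : ℕ := if Even m then catalan (m / 2) else 0

lemma semicircleSeq_two_mul (k : ℕ) : semicircleSeq (2 * k) = catalan k := by
  simp [semicircleSeq]

lemma semicircleSeq_of_odd {m : ℕ} (hm : Odd m) : semicircleSeq m = 0 := by
  simp [semicircleSeq, Nat.not_even_iff_odd.2 hm]

lemma even_of_semicircleSeq_ne_zero {m : ℕ} (hm : semicircleSeq m ≠ 0) : Even m := by
  by_contra h
  exact hm (semicircleSeq_of_odd (Nat.not_even_iff_odd.1 h))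

/-- For odd `n` only the even `p` contribute and the sum is Segner's recursion for the Catalan
numbers; for even `n` one of the indices `p` and `n - 1 - p` is odd. -/
lemma semicircleSeq_succ (n : ℕ) :
    semicircleSeq (n + 1) = ∑ p ∈ Finset.range n, semicircleSeq p * semicircleSeq (n - 1 - p) := by
  rcases Nat.even_or_odd n with hn | hn
  · rw [semicircleSeq_of_odd hn.add_one, Finset.sum_eq_zero]
    intro p hp
    rw [Finset.mem_range] at hp
    rcases Nat.even_or_odd p with h | h
    · rw [semicircleSeq_of_odd (m := n - 1 - p) (by grind), mul_zero]
    · rw [semicircleSeq_of_odd h, zero_mul]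
  · obtain ⟨k, rfl⟩ := hn
    rw [show 2 * k + 1 + 1 = 2 * (k + 1) by ring, semicircleSeq_two_mul, catalan_succ,
      Finset.sum_range (n := 2 * k + 1), Fin.sum_univ_eq_sum_range
        (fun p => catalan p * catalan (k - p)) (k + 1), ← Finset.sum_range (n := 2 * k + 1)
        (fun p => semicircleSeq p * semicircleSeq (2 * k + 1 - 1 - p))]
    symm
    apply Finset.sum_bij_ne_zero (fun p _ _ => p / 2)
    · intro p hp _
      simp only [Finset.mem_range] at *
      omega
    · intro p _ hp' q _ hq' h
      have hp2 : Even p := even_of_semicircleSeq_ne_zero (left_ne_zero_of_mul hp')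
      have hq2 : Even q := even_of_semicircleSeq_ne_zero (left_ne_zero_of_mul hq')
      grind
    · intro b hb hb'
      have hb2 : 2 * k + 1 - 1 - 2 * b = 2 * (k - b) := by omega
      refine ⟨2 * b, ?_, ?_, by omega⟩
      · simp only [Finset.mem_range] at *
        omega
      · rw [hb2, semicircleSeq_two_mul, semicircleSeq_two_mul]
        exact hb'
    · intro p hp hp'
      have hp2 : Even p := even_of_semicircleSeq_ne_zero (left_ne_zero_of_mul hp')
      obtain ⟨b, rfl⟩ := hp2
      rw [← two_mul, Nat.mul_div_cancel_left _ two_pos, semicircleSeq_two_mul,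
        show 2 * k + 1 - 1 - 2 * b = 2 * (k - b) by omega, semicircleSeq_two_mul]

/-! ### Moments of the semicircle density -/

lemma semicircleMoment_of_odd {m : ℕ} (hm : Odd m) : semicircleMoment m = 0 := by
  have h := intervalIntegral.integral_comp_neg (a := -2) (b := 2)
    (fun x : ℝ => x ^ m * Real.sqrt (4 - x ^ 2))
  simp only [hm.neg_pow, even_two.neg_pow, neg_neg, neg_mul, intervalIntegral.integral_neg] at h
  rw [semicircleMoment]
  have : ∫ x in (-2 : ℝ)..2, x ^ m * Real.sqrt (4 - x ^ 2) = 0 := by linarith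
  rw [this, mul_zero]

lemma semicircleMoment_zero : semicircleMoment 0 = 1 := by
  have h : ∫ x in (-2 : ℝ)..2, Real.sqrt (4 - x ^ 2) = 2 * Real.pi := by
    have h2 := intervalIntegral.integral_comp_mul_left (a := -1) (b := 1)
      (fun x : ℝ => Real.sqrt (4 - x ^ 2)) (c := 2) two_ne_zero
    have h3 : ∀ x : ℝ, Real.sqrt (4 - (2 * x) ^ 2) = 2 * Real.sqrt (1 - x ^ 2) := by
      intro x
      rw [show 4 - (2 * x) ^ 2 = 2 ^ 2 * (1 - x ^ 2) by ring, Real.sqrt_mul (by norm_num),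
        Real.sqrt_sq (by norm_num)]
    simp only [h3, intervalIntegral.integral_const_mul, integral_sqrt_one_sub_sq] at h2
    norm_num at h2
    linarith
  simp only [semicircleMoment, pow_zero, one_mul, h]
  field_simp

/-- Integrate the derivative of `x ^ (m + 1) * (4 - x ^ 2) ^ (3 / 2)`, which vanishes at `± 2`. -/
lemma semicircleMoment_add_two (m : ℕ) :
    (m + 4) * semicircleMoment (m + 2) = 4 * (m + 1) * semicircleMoment m := by
  have hint : ∀ n : ℕ,
      IntervalIntegrable (fun x : ℝ => x ^ n * Real.sqrt (4 - x ^ 2)) volume (-2) 2 :=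
    fun n => Continuous.intervalIntegrable (by fun_prop) _ _
  have key : ∫ x in (-2 : ℝ)..2, (4 * (m + 1) * (x ^ m * Real.sqrt (4 - x ^ 2))
      - (m + 4) * (x ^ (m + 2) * Real.sqrt (4 - x ^ 2))) = 0 := by
    rw [intervalIntegral.integral_eq_sub_of_hasDerivAt_of_le (by norm_num)
      (f := fun x => x ^ (m + 1) * ((4 - x ^ 2) * Real.sqrt (4 - x ^ 2)))]
    · norm_num
    · fun_prop
    · intro x hx
      have hpos : 0 < 4 - x ^ 2 := by nlinarith [hx.1, hx.2]
      have h1 : HasDerivAt (fun x : ℝ => 4 - x ^ 2) (-(2 * x)) x := by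
        simpa using (hasDerivAt_pow 2 x).const_sub 4
      have h2 := (hasDerivAt_pow (m + 1) x).mul (h1.mul (h1.sqrt hpos.ne'))
      refine h2.congr_deriv ?_
      have hs : Real.sqrt (4 - x ^ 2) ≠ 0 := (Real.sqrt_pos.2 hpos).ne'
      have hs2 : Real.sqrt (4 - x ^ 2) ^ 2 = 4 - x ^ 2 := Real.sq_sqrt hpos.le
      simp only [Nat.add_sub_cancel, Pi.mul_apply]
      generalize Real.sqrt (4 - x ^ 2) = s at *
      field_simp
      push_cast
      rw [hs2]
      ring
    · exact ((hint m).const_mul _).sub ((hint (m + 2)).const_mul _)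
  rw [intervalIntegral.integral_sub ((hint m).const_mul _) ((hint (m + 2)).const_mul _),
    intervalIntegral.integral_const_mul, intervalIntegral.integral_const_mul] at key
  simp only [semicircleMoment]
  linear_combination (-(1 / (2 * Real.pi))) * key

lemma semicircleMoment_two_mul (k : ℕ) : semicircleMoment (2 * k) = (catalan k : ℝ) := by
  have hcb : ∀ n : ℕ, ((n : ℝ) + 1) * catalan n = n.centralBinom := fun n => by
    exact_mod_cast succ_mul_catalan_eq_centralBinom n
  induction k with
  | zero => simpa using semicircleMoment_zero
  | succ k ih =>
    have h1 := semicircleMoment_add_two (2 * k)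
    have h2 : ((k : ℝ) + 1) * (k + 1).centralBinom = 2 * (2 * k + 1) * k.centralBinom := by
      exact_mod_cast Nat.succ_mul_centralBinom_succ k
    rw [← hcb, ← hcb] at h2
    rw [ih] at h1
    push_cast at h1 h2
    have hk : (k : ℝ) + 1 ≠ 0 := by positivity
    have hk2 : (2 * k : ℝ) + 4 ≠ 0 := by positivity
    rw [mul_add_one]
    apply mul_left_cancel₀ hk2
    apply mul_left_cancel₀ hk
    linear_combination (k + 1 : ℝ) * h1 - 2 * h2

lemma semicircleMoment_eq_semicircleSeq (m : ℕ) : semicircleMoment m = (semicircleSeq m : ℝ) := by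
  rcases Nat.even_or_odd m with hm | hm
  · obtain ⟨k, rfl⟩ := hm
    rw [← two_mul, semicircleMoment_two_mul, semicircleSeq_two_mul]
  · rw [semicircleMoment_of_odd hm, semicircleSeq_of_odd hm, Nat.cast_zero]

/-! ### Traces of powers of the generic matrix -/

section GenericMatrix

open MvPolynomial

variable {n : Type*} [Fintype n] [DecidableEq n]

/-- The Leibniz rule, one term for each of the `k` factors. -/
lemma pderiv_mvPolynomialX_pow_apply (k : ℕ) (i j a b : n) :
    pderiv (j, i) ((Matrix.mvPolynomialX n n ℂ ^ k) a b) =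
      ∑ p ∈ Finset.range k, (Matrix.mvPolynomialX n n ℂ ^ p) a j *
        (Matrix.mvPolynomialX n n ℂ ^ (k - 1 - p)) i b := by
  induction k generalizing b with
  | zero =>
    by_cases h : a = b <;> simp [Matrix.one_apply, h]
  | succ k ih =>
    have hX : ∀ c, pderiv (j, i) (Matrix.mvPolynomialX n n ℂ c b) =
        if c = j then (1 : Matrix n n (MvPolynomial (n × n) ℂ)) i b else 0 := by
      intro c
      rw [Matrix.mvPolynomialX_apply, pderiv_X, Matrix.one_apply]
      simp only [Pi.single_apply, Prod.mk.injEq]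
      grind
    rw [pow_succ, Matrix.mul_apply, map_sum]
    simp only [Derivation.leibniz, smul_eq_mul, hX, ih, Finset.sum_add_distrib, mul_ite, mul_zero,
      Finset.sum_ite_eq', Finset.mem_univ, if_true]
    rw [Finset.sum_range_succ, add_comm]
    congr 1
    · simp only [Finset.mul_sum]
      rw [Finset.sum_comm]
      refine Finset.sum_congr rfl fun p hp => ?_
      rw [Finset.mem_range] at hp
      rw [show k + 1 - 1 - p = (k - 1 - p) + 1 by omega, pow_succ, Matrix.mul_apply, Finset.mul_sum]
      exact Finset.sum_congr rfl fun c _ => by ring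
    · simp

lemma pderiv_trace_mvPolynomialX_pow (k : ℕ) (i j : n) :
    pderiv (j, i) (Matrix.mvPolynomialX n n ℂ ^ k).trace =
      k * (Matrix.mvPolynomialX n n ℂ ^ (k - 1)) i j := by
  simp only [Matrix.trace, Matrix.diag, map_sum, pderiv_mvPolynomialX_pow_apply]
  rw [Finset.sum_comm]
  have : ∀ p ∈ Finset.range k, ∑ a, (Matrix.mvPolynomialX n n ℂ ^ p) a j *
      (Matrix.mvPolynomialX n n ℂ ^ (k - 1 - p)) i a
      = (Matrix.mvPolynomialX n n ℂ ^ (k - 1)) i j := by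
    intro p hp
    rw [Finset.mem_range] at hp
    conv_rhs => rw [show k - 1 = (k - 1 - p) + p by omega, pow_add, Matrix.mul_apply]
    exact Finset.sum_congr rfl fun c _ => by ring
  rw [Finset.sum_congr rfl this]
  simp

variable (n) in
/-- The normalized trace of the `k`-th power of the generic `n × n` matrix, as a polynomial in
its entries. -/
noncomputable def genTrace (k : ℕ) : MvPolynomial (n × n) ℂ :=
  C ((Fintype.card n : ℂ)⁻¹) * (Matrix.mvPolynomialX n n ℂ ^ k).trace

lemma genTrace_zero [Nonempty n] : genTrace n 0 = 1 := by
  have h : (Fintype.card n : ℂ) ≠ 0 := by simp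
  rw [genTrace, pow_zero, Matrix.trace_one, ← C_eq_coe_nat, ← C_mul, inv_mul_cancel₀ h, C_1]

lemma pderiv_genTrace (k : ℕ) (i j : n) :
    pderiv (j, i) (genTrace n k) = C ((Fintype.card n : ℂ)⁻¹) *
      ((k : MvPolynomial (n × n) ℂ) * (Matrix.mvPolynomialX n n ℂ ^ (k - 1)) i j) := by
  rw [genTrace, ← smul_eq_C_mul, Derivation.map_smul, pderiv_trace_mvPolynomialX_pow,
    smul_eq_C_mul]

lemma eval_genTrace (k : ℕ) (M : Matrix n n ℂ) :
    eval (fun p => M p.1 p.2) (genTrace n k) = (Fintype.card n : ℂ)⁻¹ * (M ^ k).trace := by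
  have h := congrArg Matrix.trace (congrArg (· ^ k) (Matrix.mvPolynomialX_mapMatrix_eval M))
  simp only [← map_pow] at h
  rw [← h, genTrace, map_mul, eval_C]
  congr 1
  exact AddMonoidHom.map_trace (eval fun p : n × n => M p.1 p.2) _

variable (n) in
/-- The product of the normalized traces `tr (X ^ k)` of the generic matrix `X`, over the
exponents `k ∈ s` with multiplicity. -/
noncomputable def genTraceProd (s : Multiset ℕ) : MvPolynomial (n × n) ℂ :=
  (s.map (genTrace n)).prod

lemma genTraceProd_cons (k : ℕ) (s : Multiset ℕ) :
    genTraceProd n (k ::ₘ s) = genTrace n k * genTraceProd n s := by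
  simp [genTraceProd]

lemma genTraceProd_of_sum_eq_zero [Nonempty n] {s : Multiset ℕ} (hs : s.sum = 0) :
    genTraceProd n s = 1 := by
  refine Multiset.prod_eq_one fun x hx => ?_
  obtain ⟨k, hk, rfl⟩ := Multiset.mem_map.1 hx
  rw [Multiset.sum_eq_zero_iff.1 hs k hk, genTrace_zero]

lemma derivation_multiset_prod {R A ι : Type*} [CommSemiring R] [CommSemiring A] [Algebra R A]
    [DecidableEq ι] (D : Derivation R A A) (f : ι → A) (s : Multiset ι) :
    D (s.map f).prod = (s.map fun i => ((s.erase i).map f).prod * D (f i)).sum := by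
  induction s using Multiset.induction_on with
  | empty => simp
  | cons i s ih =>
    rw [Multiset.map_cons, Multiset.prod_cons, D.leibniz, Multiset.map_cons, Multiset.sum_cons,
      Multiset.erase_cons_head, smul_eq_mul, smul_eq_mul, add_comm, ih,
      ← Multiset.sum_map_mul_left]
    congr 2
    refine Multiset.map_congr rfl fun j hj => ?_
    rw [← mul_assoc, ← Multiset.prod_cons, ← Multiset.map_cons]
    rcases eq_or_ne i j with rfl | h
    · rw [Multiset.cons_erase hj, Multiset.erase_cons_head]
    · rw [Multiset.erase_cons_tail _ h]

/-- Contracting the gradient of a product of traces with a power of the generic matrix merges that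
power with each of the traces in turn. -/
lemma sum_pow_mul_pderiv_genTraceProd (k : ℕ) (s : Multiset ℕ) :
    ∑ i, ∑ j, (Matrix.mvPolynomialX n n ℂ ^ k) j i * pderiv (j, i) (genTraceProd n s) =
      (s.map fun l : ℕ => (l : ℂ) • genTraceProd n ((k + l - 1) ::ₘ s.erase l)).sum := by
  set D : Derivation ℂ (MvPolynomial (n × n) ℂ) (MvPolynomial (n × n) ℂ) :=
    ∑ i, ∑ j, (Matrix.mvPolynomialX n n ℂ ^ k) j i • pderiv (j, i) with hD
  have hDf : ∀ f, ∑ i, ∑ j, (Matrix.mvPolynomialX n n ℂ ^ k) j i * pderiv (j, i) f = D f := by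
    intro f
    rw [hD, ← Derivation.coeFnAddMonoidHom_apply]
    simp only [map_sum, Finset.sum_apply, Derivation.coeFnAddMonoidHom_apply, Derivation.smul_apply,
      smul_eq_mul]
  rw [hDf, genTraceProd, derivation_multiset_prod]
  congr 1
  refine Multiset.map_congr rfl fun l _ => ?_
  rw [genTraceProd_cons, mul_comm, ← smul_mul_assoc]
  congr 1
  rw [← hDf]
  simp only [pderiv_genTrace]
  rcases Nat.eq_zero_or_pos l with rfl | hl
  · simp
  · rw [genTrace, ← smul_eq_C_mul, Nat.add_sub_assoc hl, pow_add, Matrix.trace_mul_comm]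
    simp only [Matrix.trace, Matrix.diag, Matrix.mul_apply, Finset.smul_sum]
    refine Finset.sum_congr rfl fun i _ => Finset.sum_congr rfl fun j _ => ?_
    simp only [smul_eq_C_mul, map_natCast]
    ring

/-! ### The Schwinger–Dyson equation and the limit of the trace moments -/

/-- The linear functional `φ` on polynomials in the entries of an `N × N` matrix is normalized and
satisfies the Gaussian integration by parts `φ (X i j * f) = N⁻¹ * φ (∂ f / ∂ X j i)`, as does
`f ↦ E[f(A)]` for a GUE matrix `A`. The indices on the right are swapped because
`X j i` stands for the complex conjugate of `X i j`. -/
structure IsGUEFunctional (φ : MvPolynomial (n × n) ℂ →ₗ[ℂ] ℂ) : Prop where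
  map_one : φ 1 = 1
  map_X_mul : ∀ i j f, φ (X (i, j) * f) = (Fintype.card n : ℂ)⁻¹ * φ (pderiv (j, i) f)

lemma IsGUEFunctional.map_trace_mul {φ : MvPolynomial (n × n) ℂ →ₗ[ℂ] ℂ} (hφ : IsGUEFunctional φ)
    (k : ℕ) (f : MvPolynomial (n × n) ℂ) :
    φ ((Matrix.mvPolynomialX n n ℂ ^ (k + 1)).trace * f) =
      (Fintype.card n : ℂ)⁻¹ * (∑ p ∈ Finset.range k, φ ((Matrix.mvPolynomialX n n ℂ ^ p).trace *
        ((Matrix.mvPolynomialX n n ℂ ^ (k - 1 - p)).trace * f)) +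
        φ (∑ i, ∑ j, (Matrix.mvPolynomialX n n ℂ ^ k) j i * pderiv (j, i) f)) := by
  have h1 : (Matrix.mvPolynomialX n n ℂ ^ (k + 1)).trace * f =
      ∑ i, ∑ j, X (i, j) * ((Matrix.mvPolynomialX n n ℂ ^ k) j i * f) := by
    simp only [pow_succ', Matrix.trace, Matrix.diag, Matrix.mul_apply, Matrix.mvPolynomialX_apply,
      Finset.sum_mul, mul_assoc]
  rw [h1]
  simp only [map_sum, hφ.map_X_mul, ← Finset.mul_sum]
  congr 1
  simp only [← map_sum, ← map_add]
  congr 1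
  simp only [Derivation.leibniz, smul_eq_mul, pderiv_mvPolynomialX_pow_apply,
    Finset.sum_add_distrib]
  rw [add_comm]
  congr 1
  simp only [Finset.mul_sum, Matrix.trace, Matrix.diag, Finset.sum_mul]
  rw [Finset.sum_congr rfl fun i _ => Finset.sum_comm, Finset.sum_comm]
  refine Finset.sum_congr rfl fun p _ => ?_
  exact Finset.sum_congr rfl fun i _ => Finset.sum_congr rfl fun j _ => by ring

/-- The Schwinger–Dyson (loop) equation: integrating by parts in the first trace either splits that
trace in two or, at the cost of a factor `N⁻²`, merges it with another one. -/
lemma IsGUEFunctional.map_genTraceProd_cons_succ [Nonempty n]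
    {φ : MvPolynomial (n × n) ℂ →ₗ[ℂ] ℂ} (hφ : IsGUEFunctional φ) (k : ℕ) (s : Multiset ℕ) :
    φ (genTraceProd n ((k + 1) ::ₘ s)) =
      ∑ p ∈ Finset.range k, φ (genTraceProd n (p ::ₘ (k - 1 - p) ::ₘ s)) +
        ((Fintype.card n : ℂ)⁻¹) ^ 2 *
          (s.map fun l : ℕ => (l : ℂ) * φ (genTraceProd n ((k + l - 1) ::ₘ s.erase l))).sum := by
  have h0 : (Fintype.card n : ℂ) ≠ 0 := by simp
  rw [genTraceProd_cons, genTrace, ← smul_eq_C_mul, smul_mul_assoc, map_smul, hφ.map_trace_mul,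
    sum_pow_mul_pderiv_genTraceProd, smul_eq_mul, map_multiset_sum, Multiset.map_map, ← mul_assoc,
    mul_add, ← sq]
  congr 1
  · rw [Finset.mul_sum]
    refine Finset.sum_congr rfl fun p _ => ?_
    simp only [genTraceProd_cons, genTrace, ← smul_eq_C_mul, smul_mul_assoc, mul_smul_comm,
      map_smul, smul_eq_mul]
    ring
  · simp

/-- Products of traces factor in the limit: both kinds of terms in the Schwinger–Dyson equation have
smaller total degree, and the merging terms vanish as `N → ∞`. -/
theorem tendsto_map_genTraceProd
    (φ : ∀ N, MvPolynomial (Fin N × Fin N) ℂ →ₗ[ℂ] ℂ)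
    (hφ : ∀ N, 1 ≤ N → IsGUEFunctional (φ N)) (s : Multiset ℕ) :
    Tendsto (fun N => φ N (genTraceProd (Fin N) s)) atTop
      (𝓝 (s.map fun k => (semicircleSeq k : ℂ)).prod) := by
  induction hd : s.sum using Nat.strong_induction_on generalizing s with
  | _ d ih =>
    by_cases hs : s.sum = 0
    · have h1 : (s.map fun k => (semicircleSeq k : ℂ)).prod = 1 := by
        refine Multiset.prod_eq_one fun x hx => ?_
        obtain ⟨k, hk, rfl⟩ := Multiset.mem_map.1 hx
        simp [Multiset.sum_eq_zero_iff.1 hs k hk, semicircleSeq]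
      rw [h1]
      refine tendsto_const_nhds.congr' ?_
      filter_upwards [eventually_ge_atTop 1] with N hN
      have : Nonempty (Fin N) := ⟨⟨0, hN⟩⟩
      rw [genTraceProd_of_sum_eq_zero hs, (hφ N hN).map_one]
    · obtain ⟨l, hl, hl0⟩ : ∃ l ∈ s, l ≠ 0 := by
        by_contra! h
        exact hs (Multiset.sum_eq_zero_iff.2 h)
      obtain ⟨k, rfl⟩ := Nat.exists_eq_succ_of_ne_zero hl0
      obtain ⟨r, rfl⟩ := Multiset.exists_cons_of_mem hl
      simp only [Nat.succ_eq_add_one, Multiset.sum_cons] at *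
      have hA : Tendsto (fun N => ∑ p ∈ Finset.range k,
          φ N (genTraceProd (Fin N) (p ::ₘ (k - 1 - p) ::ₘ r))) atTop
          (𝓝 (∑ p ∈ Finset.range k, ((p ::ₘ (k - 1 - p) ::ₘ r).map
            fun k => (semicircleSeq k : ℂ)).prod)) := by
        refine tendsto_finsetSum _ fun p hp => ih _ ?_ _ rfl
        rw [Finset.mem_range] at hp
        simp only [Multiset.sum_cons]
        omega
      have hB : Tendsto (fun N => (r.map fun l : ℕ => (l : ℂ) *
          φ N (genTraceProd (Fin N) ((k + l - 1) ::ₘ r.erase l))).sum) atTop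
          (𝓝 (r.map fun l : ℕ => (l : ℂ) * (((k + l - 1) ::ₘ r.erase l).map
            fun k => (semicircleSeq k : ℂ)).prod).sum) := by
        refine tendsto_multiset_sum _ fun l hl => (ih _ ?_ _ rfl).const_mul _
        have := Multiset.sum_erase hl
        simp only [Multiset.sum_cons]
        omega
      have hN : Tendsto (fun N : ℕ => ((N : ℂ)⁻¹) ^ 2) atTop (𝓝 0) := by
        simpa using (tendsto_inv_atTop_nhds_zero_nat (𝕜 := ℂ)).pow 2
      have hlim := hA.add (hN.mul hB)
      rw [zero_mul, add_zero] at hlim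
      convert hlim.congr' ?_ using 2
      · simp only [Multiset.map_cons, Multiset.prod_cons, ← mul_assoc]
        rw [← Finset.sum_mul, semicircleSeq_succ]
        push_cast
        rfl
      · filter_upwards [eventually_ge_atTop 1] with N hN
        have : Nonempty (Fin N) := ⟨⟨0, hN⟩⟩
        rw [(hφ N hN).map_genTraceProd_cons_succ, Fintype.card_fin]

end GenericMatrix

/-! ### Random variables with finite moments -/

section Moments

variable {Ω : Type*} [MeasurableSpace Ω]

/-- The algebra of complex random variables all of whose absolute moments are finite. -/
def momentSubalgebra (P : Measure Ω) [IsFiniteMeasure P] : Subalgebra ℂ (Ω → ℂ) where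
  carrier := {f | ∀ p : ℕ, MemLp f p P}
  mul_mem' := by
    -- Hölder's inequality with exponents `2 p`, `2 p`.
    intro f g hf hg p
    have : ENNReal.HolderTriple ((2 * p : ℕ) : ENNReal) ((2 * p : ℕ) : ENNReal) (p : ENNReal) := by
      refine ⟨?_⟩
      rw [Nat.cast_mul, ENNReal.mul_inv (by simp) (by simp), ← add_mul, Nat.cast_ofNat,
        ENNReal.inv_two_add_inv_two, one_mul]
    exact (hg (2 * p)).mul (hf (2 * p))
  add_mem' := fun hf hg p => (hf p).add (hg p)
  algebraMap_mem' := fun c _ => memLp_const c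

variable {P : Measure Ω} [IsFiniteMeasure P]

lemma integrable_of_mem_momentSubalgebra {f : Ω → ℂ} (hf : f ∈ momentSubalgebra P) :
    Integrable f P := by
  simpa [memLp_one_iff_integrable] using hf 1

lemma const_mem_momentSubalgebra (c : ℂ) : (fun _ : Ω => c) ∈ momentSubalgebra P :=
  (momentSubalgebra P).algebraMap_mem c

lemma ofReal_comp_mem_momentSubalgebra {f : Ω → ℝ} (hf : ∀ p : ℕ, MemLp f p P) :
    (fun ω => (f ω : ℂ)) ∈ momentSubalgebra P := fun p => (hf p).ofReal

lemma comp_mem_momentSubalgebra {Ω' : Type*} [MeasurableSpace Ω'] {Q : Measure Ω'}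
    [IsFiniteMeasure Q] {ξ : Ω' → Ω} (hξ : HasLaw ξ P Q) {f : Ω → ℂ}
    (hf : f ∈ momentSubalgebra P) : (fun ω => f (ξ ω)) ∈ momentSubalgebra Q := by
  intro p
  have h := hf p
  rw [← hξ.map_eq] at h
  exact h.comp_of_map hξ.aemeasurable

end Moments

/-! ### Integration by parts for one Gaussian variable -/

section Gaussian

open Polynomial in
lemma polynomial_eval_mem_momentSubalgebra (p : ℂ[X]) :
    (fun x : ℝ => p.eval (x : ℂ)) ∈ momentSubalgebra (gaussianReal 0 1) := by
  have hx : (fun x : ℝ => (x : ℂ)) ∈ momentSubalgebra (gaussianReal 0 1) :=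
    ofReal_comp_mem_momentSubalgebra fun p => memLp_id_gaussianReal p
  induction p using Polynomial.induction_on' with
  | add p q hp hq => simpa using! (momentSubalgebra _).add_mem hp hq
  | monomial k a =>
    simpa using! (momentSubalgebra _).mul_mem (const_mem_momentSubalgebra a)
      ((momentSubalgebra _).pow_mem hx k)

open Polynomial in
/-- Gaussian integration by parts (Stein's identity) for polynomials. -/
lemma integral_mul_eval_gaussianReal (p : ℂ[X]) :
    ∫ x : ℝ, (x : ℂ) * p.eval (x : ℂ) ∂(gaussianReal 0 1) =
      ∫ x : ℝ, p.derivative.eval (x : ℂ) ∂(gaussianReal 0 1) := by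
  have hI : ∀ q : ℂ[X], Integrable (fun x : ℝ => gaussianPDFReal 0 1 x • q.eval (x : ℂ)) := by
    intro q
    have h := integrable_of_mem_momentSubalgebra (polynomial_eval_mem_momentSubalgebra q)
    rw [gaussianReal_of_var_ne_zero _ one_ne_zero, integrable_withDensity_iff_integrable_smul'
      (measurable_gaussianPDF _ _) (ae_of_all _ fun _ => gaussianPDF_lt_top)] at h
    simpa only [toReal_gaussianPDF] using h
  have hd : ∀ x : ℝ, HasDerivAt (fun x : ℝ => gaussianPDFReal 0 1 x • p.eval (x : ℂ))
      (gaussianPDFReal 0 1 x • (derivative p - X * p).eval (x : ℂ)) x := by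
    intro x
    have h1 : HasDerivAt (gaussianPDFReal 0 1) (-x * gaussianPDFReal 0 1 x) x := by
      have h2 : HasDerivAt (fun y : ℝ => -(y - 0) ^ 2 / (2 * ((1 : NNReal) : ℝ))) (-x) x := by
        refine ((((hasDerivAt_id x).sub_const 0).pow 2).neg.div_const _).congr_deriv ?_
        simp only [id_eq, sub_zero, NNReal.coe_one, mul_one]
        ring
      refine (h2.exp.const_mul _).congr_deriv ?_
      simp only [gaussianPDFReal]
      ring
    refine (h1.smul (p.hasDerivAt (x : ℂ)).comp_ofReal).congr_deriv ?_
    simp only [Complex.real_smul, eval_sub, eval_mul, eval_X]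
    push_cast
    ring
  have h0 := integral_eq_zero_of_hasDerivAt_of_integrable hd (hI _) (hI _)
  rw [integral_gaussianReal_eq_integral_smul one_ne_zero,
    integral_gaussianReal_eq_integral_smul one_ne_zero]
  have h3 : ∀ x : ℝ, gaussianPDFReal 0 1 x • (derivative p - X * p).eval (x : ℂ) =
      gaussianPDFReal 0 1 x • (derivative p).eval (x : ℂ) -
        gaussianPDFReal 0 1 x • (X * p).eval (x : ℂ) := fun x => by rw [eval_sub, smul_sub]
  simp only [h3] at h0
  rw [integral_sub (hI _) (hI _), sub_eq_zero] at h0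
  simpa using h0.symm

lemma integral_mul_affine_pow_gaussianReal (a b a' b' : ℂ) (k l : ℕ) :
    ∫ x : ℝ, (x : ℂ) * ((a * x + b) ^ k * (a' * x + b') ^ l) ∂(gaussianReal 0 1) =
      ∫ x : ℝ, (a * k * ((a * x + b) ^ (k - 1) * (a' * x + b') ^ l) +
        a' * l * ((a * x + b) ^ k * (a' * x + b') ^ (l - 1))) ∂(gaussianReal 0 1) := by
  have h := integral_mul_eval_gaussianReal
    ((Polynomial.C a * Polynomial.X + Polynomial.C b) ^ k *
      (Polynomial.C a' * Polynomial.X + Polynomial.C b') ^ l)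
  simp only [Polynomial.eval_mul, Polynomial.eval_pow, Polynomial.eval_add, Polynomial.eval_C,
    Polynomial.eval_X, Polynomial.derivative_mul, Polynomial.derivative_pow,
    Polynomial.derivative_add, Polynomial.derivative_C, Polynomial.derivative_X, add_zero,
    zero_mul, zero_add, mul_one] at h
  rw [h]
  congr 1
  ext x
  ring

lemma integral_pow_succ_of_hasLaw_stdRealGaussian {Ω : Type*} [MeasurableSpace Ω] {P : Measure Ω}
    {ξ : Ω → ℂ} (hξ : HasLaw ξ stdRealGaussian P) (k : ℕ) :
    ∫ ω, ξ ω ^ (k + 1) ∂P = k * ∫ ω, ξ ω ^ (k - 1) ∂P := by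
  have h1 : ∀ m : ℕ, ∫ ω, ξ ω ^ m ∂P = ∫ x : ℝ, (x : ℂ) ^ m ∂(gaussianReal 0 1) := by
    intro m
    have := hξ.integral_comp (f := fun z => z ^ m) (by fun_prop)
    simp only [Function.comp_def] at this
    rw [this, stdRealGaussian, integral_map (by fun_prop) (by fun_prop)]
  rw [h1, h1, ← integral_const_mul]
  simpa [pow_succ'] using integral_mul_affine_pow_gaussianReal 1 0 0 1 k 0

lemma mem_momentSubalgebra_of_hasLaw_stdRealGaussian {Ω : Type*} [MeasurableSpace Ω]
    {P : Measure Ω} [IsFiniteMeasure P] {ξ : Ω → ℂ} (hξ : HasLaw ξ stdRealGaussian P) :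
    ξ ∈ momentSubalgebra P := by
  have : IsProbabilityMeasure stdRealGaussian :=
    Measure.isProbabilityMeasure_map (by fun_prop)
  refine comp_mem_momentSubalgebra hξ (f := fun z => z) fun p => ?_
  rw [stdRealGaussian, memLp_map_measure_iff (by fun_prop) (by fun_prop)]
  exact (memLp_id_gaussianReal p).ofReal

lemma affine_pow_mem_momentSubalgebra_prod (a b a' b' : ℂ) (k l : ℕ) :
    (fun p : ℝ × ℝ => (a * p.1 + b * p.2) ^ k * (a' * p.1 + b' * p.2) ^ l) ∈
      momentSubalgebra ((gaussianReal 0 1).prod (gaussianReal 0 1)) := by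
  have h1 : (fun p : ℝ × ℝ => (p.1 : ℂ)) ∈
      momentSubalgebra ((gaussianReal 0 1).prod (gaussianReal 0 1)) :=
    ofReal_comp_mem_momentSubalgebra fun p =>
      (memLp_id_gaussianReal p).comp_measurePreserving measurePreserving_fst
  have h2 : (fun p : ℝ × ℝ => (p.2 : ℂ)) ∈
      momentSubalgebra ((gaussianReal 0 1).prod (gaussianReal 0 1)) :=
    ofReal_comp_mem_momentSubalgebra fun p =>
      (memLp_id_gaussianReal p).comp_measurePreserving measurePreserving_snd
  have h3 (a b : ℂ) : (fun p : ℝ × ℝ => a * p.1 + b * p.2) ∈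
      momentSubalgebra ((gaussianReal 0 1).prod (gaussianReal 0 1)) :=
    add_mem (mul_mem (const_mem_momentSubalgebra a) h1) (mul_mem (const_mem_momentSubalgebra b) h2)
  exact mul_mem (pow_mem (h3 a b) k) (pow_mem (h3 a' b') l)

lemma integrable_affine_pow_prod (a b a' b' : ℂ) (k l : ℕ) :
    Integrable (fun p : ℝ × ℝ => (a * p.1 + b * p.2) ^ k * (a' * p.1 + b' * p.2) ^ l)
      ((gaussianReal 0 1).prod (gaussianReal 0 1)) :=
  integrable_of_mem_momentSubalgebra (affine_pow_mem_momentSubalgebra_prod a b a' b' k l)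

lemma integrable_fst_mul_affine_pow_prod (a b a' b' : ℂ) (k l : ℕ) :
    Integrable (fun p : ℝ × ℝ =>
        (p.1 : ℂ) * ((a * p.1 + b * p.2) ^ k * (a' * p.1 + b' * p.2) ^ l))
      ((gaussianReal 0 1).prod (gaussianReal 0 1)) := by
  refine integrable_of_mem_momentSubalgebra (mul_mem ?_
    (affine_pow_mem_momentSubalgebra_prod a b a' b' k l))
  simpa using affine_pow_mem_momentSubalgebra_prod 1 0 0 0 1 0

/-- Integration by parts in the first of two independent standard Gaussian variables. -/
lemma integral_fst_mul_affine_pow_prod (a b a' b' : ℂ) (k l : ℕ) :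
    ∫ p : ℝ × ℝ, (p.1 : ℂ) * ((a * p.1 + b * p.2) ^ k * (a' * p.1 + b' * p.2) ^ l)
        ∂((gaussianReal 0 1).prod (gaussianReal 0 1)) =
      a * k * (∫ p : ℝ × ℝ, (a * p.1 + b * p.2) ^ (k - 1) * (a' * p.1 + b' * p.2) ^ l
        ∂((gaussianReal 0 1).prod (gaussianReal 0 1))) +
      a' * l * ∫ p : ℝ × ℝ, (a * p.1 + b * p.2) ^ k * (a' * p.1 + b' * p.2) ^ (l - 1)
        ∂((gaussianReal 0 1).prod (gaussianReal 0 1)) := by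
  have hI := integrable_affine_pow_prod a b a' b'
  rw [← integral_const_mul, ← integral_const_mul,
    ← integral_add ((hI _ _).const_mul _) ((hI _ _).const_mul _),
    integral_prod_symm _ (integrable_fst_mul_affine_pow_prod a b a' b' k l),
    integral_prod_symm (fun p : ℝ × ℝ =>
      a * k * ((a * p.1 + b * p.2) ^ (k - 1) * (a' * p.1 + b' * p.2) ^ l) +
        a' * l * ((a * p.1 + b * p.2) ^ k * (a' * p.1 + b' * p.2) ^ (l - 1)))
      (((hI _ _).const_mul _).add ((hI _ _).const_mul _))]
  congr 1
  ext y
  exact integral_mul_affine_pow_gaussianReal a (b * y) a' (b' * y) k l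

/-- Integration by parts in the second of two independent standard Gaussian variables. -/
lemma integral_snd_mul_affine_pow_prod (a b a' b' : ℂ) (k l : ℕ) :
    ∫ p : ℝ × ℝ, (p.2 : ℂ) * ((a * p.1 + b * p.2) ^ k * (a' * p.1 + b' * p.2) ^ l)
        ∂((gaussianReal 0 1).prod (gaussianReal 0 1)) =
      b * k * (∫ p : ℝ × ℝ, (a * p.1 + b * p.2) ^ (k - 1) * (a' * p.1 + b' * p.2) ^ l
        ∂((gaussianReal 0 1).prod (gaussianReal 0 1))) +
      b' * l * ∫ p : ℝ × ℝ, (a * p.1 + b * p.2) ^ k * (a' * p.1 + b' * p.2) ^ (l - 1)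
        ∂((gaussianReal 0 1).prod (gaussianReal 0 1)) := by
  have h := integral_fst_mul_affine_pow_prod b a b' a' k l
  have hs : ∀ k l : ℕ, ∫ p : ℝ × ℝ, (b * p.1 + a * p.2) ^ k * (b' * p.1 + a' * p.2) ^ l
        ∂((gaussianReal 0 1).prod (gaussianReal 0 1)) =
      ∫ p : ℝ × ℝ, (a * p.1 + b * p.2) ^ k * (a' * p.1 + b' * p.2) ^ l
        ∂((gaussianReal 0 1).prod (gaussianReal 0 1)) := by
    intro k l
    rw [← integral_prod_swap]
    simp only [Prod.fst_swap, Prod.snd_swap, add_comm]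
  rw [hs, hs, ← integral_prod_swap] at h
  simpa only [Prod.fst_swap, Prod.snd_swap, add_comm] using h

lemma integral_pow_mul_conj_pow_of_hasLaw_stdComplexGaussian {Ω : Type*} [MeasurableSpace Ω]
    {P : Measure Ω} {ξ : Ω → ℂ} (hξ : HasLaw ξ stdComplexGaussian P) (k l : ℕ) :
    ∫ ω, ξ ω ^ (k + 1) * (starRingEnd ℂ (ξ ω)) ^ l ∂P =
      l * ∫ ω, ξ ω ^ k * (starRingEnd ℂ (ξ ω)) ^ (l - 1) ∂P := by
  set c : ℂ := ((Real.sqrt 2 : ℝ) : ℂ)⁻¹ with hc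
  have hc2 : c * c = 1 / 2 := by
    rw [hc, ← mul_inv, ← Complex.ofReal_mul, Real.mul_self_sqrt (by norm_num)]
    norm_num
  -- The moments of `Z = c (X + i Y)` and its conjugate, as integrals over `(X, Y)`.
  let J : ℕ → ℕ → ℂ := fun k l => ∫ p : ℝ × ℝ,
    (c * p.1 + (c * Complex.I) * p.2) ^ k * (c * p.1 + -(c * Complex.I) * p.2) ^ l
      ∂((gaussianReal 0 1).prod (gaussianReal 0 1))
  have h1 : ∀ k l : ℕ, ∫ ω, ξ ω ^ k * (starRingEnd ℂ (ξ ω)) ^ l ∂P = J k l := by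
    intro k l
    have hf : Continuous fun z : ℂ => z ^ k * (starRingEnd ℂ z) ^ l := by fun_prop
    have := hξ.integral_comp hf.aestronglyMeasurable
    simp only [Function.comp_def] at this
    rw [this, stdComplexGaussian, integral_map (by fun_prop) hf.aestronglyMeasurable]
    congr 1
    ext p
    simp only [map_div₀, map_add, map_mul, Complex.conj_ofReal, Complex.conj_I]
    rw [hc]
    congr 2 <;> ring
  have hx : _ = c * k * J (k - 1) l + c * l * J k (l - 1) :=
    integral_fst_mul_affine_pow_prod c (c * Complex.I) c (-(c * Complex.I)) k l
  have hy : _ = c * Complex.I * k * J (k - 1) l + -(c * Complex.I) * l * J k (l - 1) :=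
    integral_snd_mul_affine_pow_prod c (c * Complex.I) c (-(c * Complex.I)) k l
  have hsplit : ∀ p : ℝ × ℝ, (c * p.1 + (c * Complex.I) * p.2) ^ (k + 1) *
      (c * p.1 + -(c * Complex.I) * p.2) ^ l =
      c * ((p.1 : ℂ) * ((c * p.1 + (c * Complex.I) * p.2) ^ k *
        (c * p.1 + -(c * Complex.I) * p.2) ^ l)) +
      c * Complex.I * ((p.2 : ℂ) * ((c * p.1 + (c * Complex.I) * p.2) ^ k *
        (c * p.1 + -(c * Complex.I) * p.2) ^ l)) := fun p => by ring
  have hI2 : Integrable (fun p : ℝ × ℝ =>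
        (p.2 : ℂ) * ((c * p.1 + (c * Complex.I) * p.2) ^ k *
          (c * p.1 + -(c * Complex.I) * p.2) ^ l))
      ((gaussianReal 0 1).prod (gaussianReal 0 1)) := by
    have := (integrable_fst_mul_affine_pow_prod (c * Complex.I) c (-(c * Complex.I)) c k l).swap
    simpa only [Function.comp_def, Prod.fst_swap, Prod.snd_swap, add_comm] using this
  rw [h1, h1]
  simp only [J, hsplit]
  rw [integral_add ((integrable_fst_mul_affine_pow_prod _ _ _ _ k l).const_mul _)
    (hI2.const_mul _), integral_const_mul, integral_const_mul, hx, hy]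
  change _ = l * J k (l - 1)
  -- The terms in `J (k - 1) l` cancel because `1 + i ^ 2 = 0`.
  linear_combination
    (k * (1 + Complex.I * Complex.I) * J (k - 1) l +
      l * (1 - Complex.I * Complex.I) * J k (l - 1)) * hc2 +
    1 / 2 * (k * J (k - 1) l - l * J k (l - 1)) * Complex.I_mul_I

lemma mem_momentSubalgebra_of_hasLaw_stdComplexGaussian {Ω : Type*} [MeasurableSpace Ω]
    {P : Measure Ω} [IsFiniteMeasure P] {ξ : Ω → ℂ} (hξ : HasLaw ξ stdComplexGaussian P) :
    ξ ∈ momentSubalgebra P := by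
  have : IsProbabilityMeasure stdComplexGaussian :=
    Measure.isProbabilityMeasure_map (by fun_prop)
  refine comp_mem_momentSubalgebra hξ (f := fun z => z) fun p => ?_
  rw [stdComplexGaussian, memLp_map_measure_iff (by fun_prop) (by fun_prop)]
  have h := affine_pow_mem_momentSubalgebra_prod (((Real.sqrt 2 : ℝ) : ℂ)⁻¹)
    (((Real.sqrt 2 : ℝ) : ℂ)⁻¹ * Complex.I) 0 0 1 0 p
  convert h using 2 with q
  simp only [Function.comp_apply, pow_one, pow_zero, mul_one]
  ring

end Gaussian

section GaussianMatrix

/-! ### Integration by parts for Gaussian matrices -/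

open MvPolynomial

section Expectation

variable {Ω : Type*} [MeasurableSpace Ω] {P : Measure Ω} [IsFiniteMeasure P]

lemma eval_mem_momentSubalgebra {σ : Type*} {ξ : σ → Ω → ℂ}
    (hξ : ∀ s, ξ s ∈ momentSubalgebra P) (f : MvPolynomial σ ℂ) :
    (fun ω => eval (fun s => ξ s ω) f) ∈ momentSubalgebra P := by
  induction f using MvPolynomial.induction_on with
  | C a => simpa using const_mem_momentSubalgebra a
  | add p q hp hq => simpa using! add_mem hp hq
  | mul_X p s hp => simpa using! mul_mem hp (hξ s)

/-- The expectation `f ↦ E[f(ξ)]` of polynomials in random variables with finite moments. -/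
noncomputable def polyExpectation {σ : Type*} (ξ : σ → Ω → ℂ)
    (hξ : ∀ s, ξ s ∈ momentSubalgebra P) : MvPolynomial σ ℂ →ₗ[ℂ] ℂ where
  toFun f := ∫ ω, eval (fun s => ξ s ω) f ∂P
  map_add' f g := by
    simp only [map_add]
    exact integral_add (integrable_of_mem_momentSubalgebra (eval_mem_momentSubalgebra hξ f))
      (integrable_of_mem_momentSubalgebra (eval_mem_momentSubalgebra hξ g))
  map_smul' c f := by
    simp only [smul_eval, RingHom.id_apply, smul_eq_mul, integral_const_mul]

lemma polyExpectation_apply {σ : Type*} (ξ : σ → Ω → ℂ)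
    (hξ : ∀ s, ξ s ∈ momentSubalgebra P) (f : MvPolynomial σ ℂ) :
    polyExpectation ξ hξ f = ∫ ω, eval (fun s => ξ s ω) f ∂P := rfl

end Expectation

variable {Ω : Type*} [MeasurableSpace Ω] {P : Measure Ω} {n : Type*} [Fintype n] [LinearOrder n]

/-- A product over all pairs of indices, grouped by the pairs on and below the diagonal. -/
lemma prod_eq_prod_lower {M : Type*} [CommMonoid M] (g : n × n → M) :
    ∏ p, g p = ∏ q : {p : n × n // p.2 ≤ p.1},
      g q.1 * (if q.1.1 = q.1.2 then 1 else g q.1.swap) := by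
  rw [← Finset.prod_subtype (Finset.univ.filter fun p : n × n => p.2 ≤ p.1) (by simp)
      (fun p => g p * (if p.1 = p.2 then 1 else g p.swap)), Finset.prod_mul_distrib,
    ← Finset.prod_filter_mul_prod_filter_not Finset.univ (fun p : n × n => p.2 ≤ p.1)]
  congr 1
  simp only [← ite_not (p := (_ : n) = _)]
  rw [← Finset.prod_filter]
  refine Finset.prod_bij (fun p _ => p.swap) ?_ ?_ ?_ ?_
  · intro p hp
    simp only [Finset.mem_filter, Finset.mem_univ, true_and, not_le, Prod.fst_swap,
      Prod.snd_swap] at hp ⊢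
    exact ⟨hp.le, hp.ne'⟩
  · intro p _ q _ h
    exact Prod.swap_injective h
  · intro p hp
    simp only [Finset.mem_filter, Finset.mem_univ, true_and] at hp
    refine ⟨p.swap, ?_, p.swap_swap⟩
    simpa using lt_of_le_of_ne hp.1 (Ne.symm hp.2)
  · intro p _
    rw [Prod.swap_swap]

/-- The moments of the entries of a random matrix whose entries on and below the diagonal are
independent factor over these entries. -/
lemma integral_prod_pow_eq_prod_lower {A : Ω → Matrix n n ℂ}
    (hherm : ∀ᵐ ω ∂P, (A ω).IsHermitian)
    (hind : iIndepFun (fun (p : {p : n × n // p.2 ≤ p.1}) (ω : Ω) => A ω p.1.1 p.1.2) P)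
    (hmeas : ∀ i j, AEMeasurable (fun ω => A ω i j) P) (m : n × n → ℕ) :
    ∫ ω, ∏ p : n × n, A ω p.1 p.2 ^ m p ∂P =
      ∏ q : {p : n × n // p.2 ≤ p.1}, ∫ ω, A ω q.1.1 q.1.2 ^ m q.1 *
        (if q.1.1 = q.1.2 then 1 else A ω q.1.2 q.1.1 ^ m q.1.swap) ∂P := by
  have hconj : ∀ᵐ ω ∂P, ∀ i j, A ω j i = starRingEnd ℂ (A ω i j) := by
    filter_upwards [hherm] with ω h i j
    exact (h.apply j i).symm
  have h1 := hind.integral_fun_prod_comp (fun _ => hmeas _ _)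
    (f := fun q z => z ^ m q.1 *
      (if q.1.1 = q.1.2 then 1 else (starRingEnd ℂ z) ^ m q.1.swap))
    (fun q => by
      refine Continuous.aestronglyMeasurable ?_
      split_ifs <;> fun_prop)
  calc _ = _ := integral_congr_ae (by
        filter_upwards [hconj] with ω h
        rw [prod_eq_prod_lower]
        refine Finset.prod_congr rfl fun q _ => ?_
        rw [← h]
        rfl)
    _ = _ := h1
    _ = _ := Finset.prod_congr rfl fun q _ => integral_congr_ae (by
        filter_upwards [hconj] with ω h
        rw [← h])

/-- Gaussian integration by parts for polynomials in the entries of a Hermitian random matrix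
follows from its one-entry instances, since the mixed moments factor by independence. -/
lemma polyExpectation_X_mul [IsProbabilityMeasure P] {A : Ω → Matrix n n ℂ} {v : ℂ}
    (hherm : ∀ᵐ ω ∂P, (A ω).IsHermitian)
    (hind : iIndepFun (fun (p : {p : n × n // p.2 ≤ p.1}) (ω : Ω) => A ω p.1.1 p.1.2) P)
    (hmom : ∀ p : n × n, (fun ω => A ω p.1 p.2) ∈ momentSubalgebra P)
    (hdiag : ∀ i, ∀ k : ℕ, ∫ ω, A ω i i ^ (k + 1) ∂P = v * k * ∫ ω, A ω i i ^ (k - 1) ∂P)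
    (hoff : ∀ i j, i ≠ j → ∀ k l : ℕ, ∫ ω, A ω i j ^ (k + 1) * A ω j i ^ l ∂P =
      v * l * ∫ ω, A ω i j ^ k * A ω j i ^ (l - 1) ∂P)
    (i j : n) (f : MvPolynomial (n × n) ℂ) :
    polyExpectation (fun p : n × n => fun ω => A ω p.1 p.2) hmom (X (i, j) * f) =
      v * polyExpectation (fun p : n × n => fun ω => A ω p.1 p.2) hmom (pderiv (j, i) f) := by
  set φ := polyExpectation (fun p : n × n => fun ω => A ω p.1 p.2) hmom with hφ
  have hmeas : ∀ i j, AEMeasurable (fun ω => A ω i j) P := fun i j =>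
    (integrable_of_mem_momentSubalgebra (hmom (i, j))).aemeasurable
  have hmono : ∀ (m : n × n →₀ ℕ) (c : ℂ), φ (monomial m c) =
      c * ∏ q : {p : n × n // p.2 ≤ p.1}, ∫ ω, A ω q.1.1 q.1.2 ^ m q.1 *
        (if q.1.1 = q.1.2 then 1 else A ω q.1.2 q.1.1 ^ m q.1.swap) ∂P := by
    intro m c
    rw [← integral_prod_pow_eq_prod_lower hherm hind hmeas, hφ, polyExpectation_apply,
      ← integral_const_mul]
    congr 1
    ext ω
    rw [eval_monomial, Finsupp.prod_fintype _ _ (fun _ => pow_zero _)]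
  -- By linearity it suffices to treat monomials.
  suffices h : φ ∘ₗ LinearMap.mulLeft ℂ (X (i, j)) = v • φ ∘ₗ (pderiv (j, i)).toLinearMap from
    LinearMap.congr_fun h f
  refine MvPolynomial.linearMap_ext fun m => LinearMap.ext_ring ?_
  simp only [LinearMap.comp_apply, LinearMap.mulLeft_apply, LinearMap.smul_apply, smul_eq_mul,
    Derivation.coeFn_coe, pderiv_monomial, X, monomial_mul, hmono,
    one_mul]
  -- Only the factor of the entry `{i, j}` on or below the diagonal involves the two variables.
  set q₀ : {p : n × n // p.2 ≤ p.1} :=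
    if h : j ≤ i then ⟨(i, j), h⟩ else ⟨(j, i), (not_le.1 h).le⟩ with hq₀
  rw [← Finset.mul_prod_erase _ _ (Finset.mem_univ q₀),
    ← Finset.mul_prod_erase (Finset.univ : Finset {p : n × n // p.2 ≤ p.1}) _
      (Finset.mem_univ q₀), ← mul_assoc, ← mul_assoc]
  congr 1
  · rcases lt_trichotomy j i with h | rfl | h
    · have hne : i ≠ j := h.ne'
      have e1 : (i, j) ≠ (j, i) := by simp [hne]
      have := hoff i j hne (m (i, j)) (m (j, i))
      simp only [hq₀, h.le, dif_pos, hne, if_false, Prod.swap_prod_mk, Finsupp.add_apply,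
        Finsupp.tsub_apply, Finsupp.single_apply, e1, e1.symm, if_true, zero_add, tsub_zero]
      rw [add_comm 1, this]
    · have := hdiag j (m (j, j))
      simp only [hq₀, le_refl, dif_pos, if_true, mul_one, Finsupp.add_apply, Finsupp.tsub_apply,
        Finsupp.single_apply]
      rw [add_comm 1, this]
    · have hne : i ≠ j := h.ne
      have e1 : (i, j) ≠ (j, i) := by simp [hne]
      have := hoff i j hne (m (i, j)) (m (j, i))
      simp only [hq₀, not_le.2 h, dif_neg, not_false_eq_true, hne.symm, if_false,
        Prod.swap_prod_mk, Finsupp.add_apply,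
        Finsupp.tsub_apply, Finsupp.single_apply, e1, e1.symm, if_true, zero_add, tsub_zero]
      simp only [mul_comm (A _ j i ^ _)]
      rw [add_comm 1, this]
  · refine Finset.prod_congr rfl fun q hq => ?_
    have hne : q ≠ q₀ := Finset.ne_of_mem_erase hq
    have hq1 : q.1 ≠ (i, j) ∧ q.1 ≠ (j, i) := by
      obtain ⟨⟨a, b⟩, hab⟩ := q
      by_cases h : j ≤ i
      · simp only [hq₀, h, dif_pos, ne_eq, Subtype.mk.injEq] at hne
        refine ⟨hne, fun h' => ?_⟩
        simp only [Prod.mk.injEq] at h' hne hab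
        obtain ⟨rfl, rfl⟩ := h'
        exact hne ⟨le_antisymm h hab, le_antisymm hab h⟩
      · simp only [hq₀, h, dif_neg, not_false_eq_true, ne_eq, Subtype.mk.injEq] at hne
        refine ⟨fun h' => ?_, hne⟩
        simp only [Prod.mk.injEq] at h' hab
        obtain ⟨rfl, rfl⟩ := h'
        exact h hab
    have hq2 : q.1.swap ≠ (i, j) ∧ q.1.swap ≠ (j, i) := by
      obtain ⟨⟨a, b⟩, hab⟩ := q
      simp only [ne_eq, Prod.mk.injEq, Prod.swap_prod_mk] at *
      tauto
    simp only [Finsupp.add_apply, Finsupp.tsub_apply, Finsupp.single_apply, hq1.1.symm,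
      hq1.2.symm, hq2.1.symm, hq2.2.symm, if_false, zero_add, tsub_zero]

/-- A normalized GUE matrix has an expectation functional with Gaussian integration by parts. -/
lemma IsGUE.exists_isGUEFunctional {Ω : Type*} [MeasurableSpace Ω] {P : Measure Ω}
    [IsProbabilityMeasure P] {N : ℕ} {A : Ω → Matrix (Fin N) (Fin N) ℂ} (hA : IsGUE P A) :
    ∃ hmom : ∀ p : Fin N × Fin N, (fun ω => A ω p.1 p.2) ∈ momentSubalgebra P,
      IsGUEFunctional (polyExpectation (fun p : Fin N × Fin N => fun ω => A ω p.1 p.2) hmom) := by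
  obtain ⟨a, ha, hAa⟩ := hA
  set r : ℂ := (((Real.sqrt N)⁻¹ : ℝ) : ℂ) with hr
  have hr2 : r * r = (N : ℂ)⁻¹ := by
    rw [hr, ← Complex.ofReal_mul, ← mul_inv, Real.mul_self_sqrt (Nat.cast_nonneg N)]
    simp
  have hAe : ∀ ω i j, A ω i j = r * a ω i j := fun ω i j => by rw [hAa]; rfl
  have hmom_a : ∀ i j, (fun ω => a ω i j) ∈ momentSubalgebra P := by
    intro i j
    rcases eq_or_ne i j with rfl | h
    · exact mem_momentSubalgebra_of_hasLaw_stdRealGaussian (ha.diag_law i)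
    · exact mem_momentSubalgebra_of_hasLaw_stdComplexGaussian (ha.offDiag_law i j h)
  have hmom : ∀ p : Fin N × Fin N, (fun ω => A ω p.1 p.2) ∈ momentSubalgebra P := by
    intro p
    simp only [hAe]
    exact mul_mem (const_mem_momentSubalgebra r) (hmom_a _ _)
  refine ⟨hmom, by simp [polyExpectation_apply], fun i j f => ?_⟩
  rw [Fintype.card_fin]
  refine polyExpectation_X_mul ?_ ?_ hmom ?_ ?_ i j f
  · filter_upwards [ha.selfadjoint] with ω h
    rw [hAa]
    exact h.smul (Complex.conj_ofReal _)
  · simp only [hAe]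
    exact ha.indep.comp (fun _ z => r * z) (fun _ => by fun_prop)
  · intro i k
    simp only [hAe, mul_pow, integral_const_mul]
    rw [integral_pow_succ_of_hasLaw_stdRealGaussian (ha.diag_law i), ← hr2]
    rcases k with _ | k
    · simp
    · simp only [Nat.add_sub_cancel]
      ring
  · intro i j hij k l
    have hconj : ∀ k l : ℕ, ∫ ω, A ω i j ^ k * A ω j i ^ l ∂P =
        r ^ k * r ^ l * ∫ ω, a ω i j ^ k * (starRingEnd ℂ (a ω i j)) ^ l ∂P := by
      intro k l
      rw [← integral_const_mul]
      refine integral_congr_ae ?_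
      filter_upwards [ha.selfadjoint] with ω h
      rw [hAe, hAe, ← h.apply j i]
      simp only [RCLike.star_def]
      ring
    rw [hconj, hconj, integral_pow_mul_conj_pow_of_hasLaw_stdComplexGaussian
      (ha.offDiag_law i j hij), ← hr2]
    rcases l with _ | l
    · simp
    · simp only [Nat.add_sub_cancel]
      ring

lemma normTrace_pow_eq_eval {N : ℕ} (M : Matrix (Fin N) (Fin N) ℂ) (m : ℕ) :
    normTrace (M ^ m) = eval (fun p => M p.1 p.2) (genTrace (Fin N) m) := by
  rw [eval_genTrace, normTrace, Fintype.card_fin, one_div]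

end GaussianMatrix

end GUE


theorem theorem2p21 {Ω : ℕ → Type*} [∀ N, MeasurableSpace (Ω N)]
    (P : ∀ N, Measure (Ω N)) [∀ N, IsProbabilityMeasure (P N)]
    (A : ∀ N, Ω N → Matrix (Fin N) (Fin N) ℂ)
    (hA : ∀ N, 1 ≤ N → GUE.IsGUE (P N) (A N)) (m : ℕ) :
    (∀ N, 1 ≤ N → Integrable (fun ω => GUE.normTrace (A N ω ^ m)) (P N)) ∧
    Tendsto (fun N => ∫ ω, GUE.normTrace (A N ω ^ m) ∂(P N)) atTop
      (𝓝 ((GUE.semicircleMoment m : ℝ) : ℂ)) ∧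
    (Odd m → GUE.semicircleMoment m = 0) ∧
    (∀ k : ℕ, m = 2 * k → GUE.semicircleMoment m = (catalan k : ℝ)) := by
  refine ⟨fun N hN => ?_, ?_, GUE.semicircleMoment_of_odd, ?_⟩
  · obtain ⟨hmom, -⟩ := (hA N hN).exists_isGUEFunctional
    simp only [GUE.normTrace_pow_eq_eval]
    exact GUE.integrable_of_mem_momentSubalgebra (GUE.eval_mem_momentSubalgebra hmom _)
  · have hφ : ∀ N, ∃ φ : MvPolynomial (Fin N × Fin N) ℂ →ₗ[ℂ] ℂ, 1 ≤ N →
        GUE.IsGUEFunctional φ ∧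
          φ (GUE.genTrace (Fin N) m) = ∫ ω, GUE.normTrace (A N ω ^ m) ∂(P N) := by
      intro N
      by_cases hN : 1 ≤ N
      · obtain ⟨hmom, h⟩ := (hA N hN).exists_isGUEFunctional
        refine ⟨_, fun _ => ⟨h, ?_⟩⟩
        simp only [GUE.normTrace_pow_eq_eval]
        rfl
      -- Nothing is assumed for `N = 0`, so any functional will do.
      · exact ⟨0, fun h => absurd h hN⟩
    choose φ hφ using hφ
    have h := GUE.tendsto_map_genTraceProd φ (fun N hN => (hφ N hN).1) {m}
    simp only [Multiset.map_singleton, Multiset.prod_singleton] at h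
    rw [GUE.semicircleMoment_eq_semicircleSeq, Complex.ofReal_natCast]
    refine h.congr' ?_
    filter_upwards [eventually_ge_atTop 1] with N hN
    rw [← (hφ N hN).2, GUE.genTraceProd, Multiset.map_singleton, Multiset.prod_singleton]
  · rintro k rfl
    exact GUE.semicircleMoment_two_mul k
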